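/- Let $\mathcal M$ be a finite-dimensional smooth Riemannian manifold whose metric structure is its Riemannian distance $d$ (for instance a Hadamard manifold). For $x,y\in\mathcal M$ write $v=\mathrm{Exp}_x^{-1}(y)$ if $v\in T_x\mathcal M$ is the initial velocity $\dot\gamma(0)$ of a minimizing geodesic $\gamma:[0,1]\to\mathcal M$ from $x$ to $y$; on a Hadamard manifold $\gamma$ and $v$ exist and are unique, and in general every statement below is meant for all such $v$ and $\gamma$. Let $\mathcal X\subset\mathcal M$ be compact and geodesically convex: any two points of $\mathcal X$ are joined by a minimizing geodesic of $\mathcal M$, and every such geodesic stays in $\mathcal X$. Let $\phi:\mathcal M\to\mathbb R$ be differentiable at the points of $\mathcal X$, with Riemannian gradient $\operatorname{grad}\phi$, and suppose that, for all $x,y\in\mathcal X$, $$\phi(y)\ge\phi(x)+\langle\operatorname{grad}\phi(x),\mathrm{Exp}_x^{-1}(y)\rangle_x\quad\text{(g-convexity)},\qquad \|\operatorname{grad}\phi(y)-\Gamma_x^y\operatorname{grad}\phi(x)\|_y\le L\,d(x,y)\quad\text{($L$-smoothness)},$$ where $\Gamma_x^y$ is parallel transport along a minimizing geodesic from $x$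 to $y$. Let $x^*\in\mathcal X$ be a minimum of $\phi$ over $\mathcal X$, and define the curvature constant $$M_\phi:=\sup\ \frac{2}{\eta^2}\Big[\phi(y)-\phi(x)-\langle\operatorname{grad}\phi(x),\mathrm{Exp}_x^{-1}(y)\rangle_x\Big],$$ the supremum being over $x,z\in\mathcal X$, $\eta\in(0,1]$ and $y=\gamma_{xz}(\eta)$, with $\gamma_{xz}:[0,1]\to\mathcal M$ a minimizing geodesic from $x$ to $z$. Let $(x_k)_{k\ge0}$ be generated by Riemannian Frank–Wolfe with step sizes $s_k=\frac{2}{k+2}$: $x_0\in\mathcal X$, and for every $k\ge0$ $$z_k\in\operatorname*{argmin}_{z\in\mathcal X}\ \langle\operatorname{grad}\phi(x_k),\mathrm{Exp}_{x_k}^{-1}(z)\rangle_{x_k},\qquad x_{k+1}=\gamma_k(s_k),$$ where $\gamma_k:[0,1]\to\mathcal M$ is the minimizing geodesic with $\gamma_k(0)=x_k$, $\gamma_k(1)=z_k$ and $\dot\gamma_k(0)=\mathrm{Exp}_{x_k}^{-1}(z_k)$. Then $M_\phi$ is finite, $M_\phi\le L\,\mathrm{diam}(\mathcal X)^2$, and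 $$\phi(x_k)-\phi(x^*)\le\frac{2M_\phi}{k+2}\qquad\text{for all }k\ge1;$$ in particular $\phi(x_k)-\phi(x^*)=O(1/k)$. -/

import Mathlib

open Bundle Set Filter Manifold
open scoped ContDiff Topology

noncomputable section

namespace RFW

section Geometry

variable {E : Type*} [NormedAddCommGroup E] [NormedSpace ℝ E]
  {M : Type*} [MetricSpace M] [ChartedSpace E M]
  [RiemannianBundle (fun x : M => TangentSpace 𝓘(ℝ, E) x)]

/-- The inverse of the chart centred at `p`, as a map from the model space to `M`. -/
def chartInv (p : M) (u : E) : M := (extChartAt 𝓘(ℝ, E) p).symm u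

/-- The coefficients `g_u(v, w)` of the Riemannian metric in the chart centred at `p`. -/
def chartMetric (p : M) (u v w : E) : ℝ :=
  inner ℝ
    ((mfderiv 𝓘(ℝ, E) 𝓘(ℝ, E) (chartInv p) u v : TangentSpace 𝓘(ℝ, E) (chartInv p u)))
    ((mfderiv 𝓘(ℝ, E) 𝓘(ℝ, E) (chartInv p) u w : TangentSpace 𝓘(ℝ, E) (chartInv p u)))

/-- Christoffel symbols of the first kind of the Levi-Civita connection in the chart centred
at `p`: the value `g_u(Γ_u(v, w), z)`, given by
`(∂_v g(w, z) + ∂_w g(v, z) - ∂_z g(v, w)) / 2`. -/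
def christoffel (p : M) (u v w z : E) : ℝ :=
  (fderiv ℝ (fun u' => chartMetric p u' w z) u v
    + fderiv ℝ (fun u' => chartMetric p u' v z) u w
    - fderiv ℝ (fun u' => chartMetric p u' v w) u z) / 2

/-- The velocity `γ'(t)` of a curve parametrised by `[0, 1]` (one-sided at the end points). -/
def velocity (γ : ℝ → M) (t : ℝ) : TangentSpace 𝓘(ℝ, E) (γ t) :=
  mfderivWithin 𝓘(ℝ, ℝ) 𝓘(ℝ, E) γ (Icc 0 1) t (1 : ℝ)

/-- The curve `γ` read in the chart centred at `p`. -/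
def coordCurve (p : M) (γ : ℝ → M) (s : ℝ) : E := extChartAt 𝓘(ℝ, E) p (γ s)

/-- The vector field `V` along `γ` read in the chart centred at `p`. -/
def coordField (p : M) (γ : ℝ → M) (V : ∀ s, TangentSpace 𝓘(ℝ, E) (γ s)) (s : ℝ) : E :=
  mfderiv 𝓘(ℝ, E) 𝓘(ℝ, E) (extChartAt 𝓘(ℝ, E) p) (γ s) (V s)

/-- `V` is a parallel vector field along `γ : [0, 1] → M`: at every time `t` its covariant
derivative `D_t V = v' + Γ(c', v)` vanishes, where `c` and `v` are `γ` and `V` in the chart centred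
at `γ t`. The equation `D_t V = 0` is tested against every tangent vector `z`. -/
def IsParallelAlong (γ : ℝ → M) (V : ∀ s, TangentSpace 𝓘(ℝ, E) (γ s)) : Prop :=
  ∀ t ∈ Icc (0 : ℝ) 1, ∃ c' v' : E,
    HasDerivWithinAt (coordCurve (E := E) (γ t) γ) c' (Icc 0 1) t ∧
    HasDerivWithinAt (coordField (γ t) γ V) v' (Icc 0 1) t ∧
    ∀ z : E,
      chartMetric (γ t) (coordCurve (E := E) (γ t) γ t) v' z
        + christoffel (γ t) (coordCurve (E := E) (γ t) γ t) c' (coordField (γ t) γ V t) z = 0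

/-- `w = Γ_γ u`: the vector `w` at `γ 1` is the parallel transport of the vector `u` at `γ 0`
along `γ : [0, 1] → M`. -/
def IsParallelTransport (γ : ℝ → M) (u : TangentSpace 𝓘(ℝ, E) (γ 0))
    (w : TangentSpace 𝓘(ℝ, E) (γ 1)) : Prop :=
  ∃ V : ∀ s, TangentSpace 𝓘(ℝ, E) (γ s), IsParallelAlong γ V ∧ V 0 = u ∧ V 1 = w

variable (E) in
/-- `γ : [0, 1] → M` is a geodesic: a smooth curve whose velocity is parallel along it. -/
def IsGeodesic (γ : ℝ → M) : Prop :=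
  ContMDiffOn 𝓘(ℝ, ℝ) 𝓘(ℝ, E) ∞ γ (Icc 0 1) ∧ IsParallelAlong γ (velocity (E := E) γ)

variable (E) in
/-- `γ : [0, 1] → M` is a minimizing geodesic: its length is the distance of its end points. -/
def IsMinGeodesic (γ : ℝ → M) : Prop :=
  IsGeodesic E γ ∧ Manifold.pathELength 𝓘(ℝ, E) γ 0 1 = edist (γ 0) (γ 1)

/-- `γ : [0, 1] → M` is a minimizing geodesic from `x` to `y` with initial velocity `v ∈ T_x M`. -/
def IsMinGeodesicFrom (γ : ℝ → M) (x y : M) (v : TangentSpace 𝓘(ℝ, E) x) : Prop :=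
  IsMinGeodesic E γ ∧ γ 1 = y ∧
    (⟨γ 0, velocity γ 0⟩ : TangentBundle 𝓘(ℝ, E) M) = ⟨x, v⟩

/-- `v = Exp_x⁻¹ y`: the vector `v ∈ T_x M` is the initial velocity of a minimizing geodesic
`γ : [0, 1] → M` from `x` to `y`. On a Hadamard manifold there is exactly one such vector; in
general `Exp_x⁻¹ y` is the set of all of them. -/
def IsInvExp (x y : M) (v : TangentSpace 𝓘(ℝ, E) x) : Prop :=
  ∃ γ : ℝ → M, IsMinGeodesicFrom γ x y v

variable (E) in
/-- `X` is geodesically convex: any two of its points are joined by a minimizing geodesic of `M`,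
and each such geodesic stays in `X`. -/
def IsGConvexSet (X : Set M) : Prop :=
  (∀ x ∈ X, ∀ y ∈ X, ∃ v : TangentSpace 𝓘(ℝ, E) x, IsInvExp x y v) ∧
  ∀ γ : ℝ → M, IsMinGeodesic E γ → γ 0 ∈ X → γ 1 ∈ X → ∀ t ∈ Icc (0 : ℝ) 1, γ t ∈ X

end Geometry

section Optimization

variable (E : Type*) [NormedAddCommGroup E] [NormedSpace ℝ E] [FiniteDimensional ℝ E]
  {M : Type*} [MetricSpace M] [ChartedSpace E M]
  [RiemannianBundle (fun x : M => TangentSpace 𝓘(ℝ, E) x)]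

/-- The Riemannian gradient: the vector of `T_x M` that represents the differential of `φ`
at `x` through the inner product. -/
def grad (φ : M → ℝ) (x : M) : TangentSpace 𝓘(ℝ, E) x :=
  haveI : FiniteDimensional ℝ (TangentSpace 𝓘(ℝ, E) x) :=
    inferInstanceAs (FiniteDimensional ℝ E)
  haveI : CompleteSpace (TangentSpace 𝓘(ℝ, E) x) := FiniteDimensional.complete ℝ _
  (InnerProductSpace.toDual ℝ (TangentSpace 𝓘(ℝ, E) x)).symm (mfderiv 𝓘(ℝ, E) 𝓘(ℝ, ℝ) φ x)

/-- `φ` is geodesically convex on `X`. -/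
def IsGConvexOn (φ : M → ℝ) (X : Set M) : Prop :=
  ∀ x ∈ X, ∀ y ∈ X, ∀ v : TangentSpace 𝓘(ℝ, E) x, IsInvExp x y v →
    φ x + inner ℝ (grad E φ x) v ≤ φ y

/-- `φ` is `L`-smooth on `X`: `‖grad φ(y) - Γ_x^y grad φ(x)‖ ≤ L d(x, y)` for all `x, y ∈ X`, with
the parallel transport `Γ_x^y` along minimizing geodesics `γ` from `x = γ 0` to `y = γ 1`. -/
def IsLSmoothOn (L : ℝ) (φ : M → ℝ) (X : Set M) : Prop :=
  (∀ x ∈ X, MDifferentiableAt 𝓘(ℝ, E) 𝓘(ℝ, ℝ) φ x) ∧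
  ∀ γ : ℝ → M, IsMinGeodesic E γ → γ 0 ∈ X → γ 1 ∈ X →
    ∃ w : TangentSpace 𝓘(ℝ, E) (γ 1), IsParallelTransport γ (grad E φ (γ 0)) w ∧
      ‖grad E φ (γ 1) - w‖ ≤ L * dist (γ 0) (γ 1)

/-- The values `(2 / η²) (φ(y) - φ(x) - ⟨grad φ(x), Exp_x⁻¹ y⟩)` with `x, z ∈ X`, `0 < η ≤ 1` and
`y = γ η` on a minimizing geodesic `γ` from `x = γ 0` to `z = γ 1`. -/
def curvatureValues (φ : M → ℝ) (X : Set M) : Set ℝ :=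
  {r | ∃ γ : ℝ → M, IsMinGeodesic E γ ∧ γ 0 ∈ X ∧ γ 1 ∈ X ∧
    ∃ η ∈ Ioc (0 : ℝ) 1, ∃ w : TangentSpace 𝓘(ℝ, E) (γ 0), IsInvExp (γ 0) (γ η) w ∧
      r = 2 / η ^ 2 * (φ (γ η) - φ (γ 0) - inner ℝ (grad E φ (γ 0)) w)}

/-- The curvature constant `M_φ`. -/
def curvatureConst (φ : M → ℝ) (X : Set M) : ℝ := sSup (curvatureValues E φ X)

variable {E} in
/-- `z ∈ X`, with `v = Exp_x⁻¹ z`, is an answer of the Riemannian linear oracle at `x`: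
it minimizes `⟨grad φ(x), Exp_x⁻¹ z⟩` over `z ∈ X`. -/
def IsLinearOracle (φ : M → ℝ) (X : Set M) (x z : M) (v : TangentSpace 𝓘(ℝ, E) x) : Prop :=
  z ∈ X ∧ IsInvExp x z v ∧
    ∀ z' ∈ X, ∀ v' : TangentSpace 𝓘(ℝ, E) x, IsInvExp x z' v' →
      inner ℝ (grad E φ x) v ≤ inner ℝ (grad E φ x) v'

/-- `x` is a sequence of iterates of Riemannian Frank-Wolfe with step sizes `s`: it starts in `X`,
and `x (k + 1) = γ (s k)` for a minimizing geodesic `γ` from `x k` to a point `z` returned by the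
linear oracle at `x k`. -/
def IsRFWSequence (φ : M → ℝ) (X : Set M) (s : ℕ → ℝ) (x : ℕ → M) : Prop :=
  x 0 ∈ X ∧ ∀ k, ∃ (z : M) (v : TangentSpace 𝓘(ℝ, E) (x k)) (γ : ℝ → M),
    IsLinearOracle φ X (x k) z v ∧ IsMinGeodesicFrom γ (x k) z v ∧ x (k + 1) = γ (s k)

end Optimization

end RFW

end

/-! Two facts carry the theorem. The first is metric compatibility of the Levi-Civita connection:
inner products of parallel fields are constant (`inner_eq_of_isParallelAlong`). Hence geodesics have
constant speed, and pairing the parallel field of the smoothness condition with the velocity gives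
`⟨grad φ, γ'⟩` at time 1 minus its value at time 0 at most `L d²`. On the restrictions `s ↦ γ (t s)`
this bounds the growth of `(φ ∘ γ)'`, and integration gives `φ(y) ≤ φ(x) + ⟨grad φ(x), Exp_x⁻¹ y⟩ +
(L/2) d(x, y)²` (`IsLSmoothOn.le_add_of_isMinGeodesic`). Since `d(x, y) = η d(x, z)`, the factor
`2/η²` cancels and every curvature value is at most `L diam²`.

The second is the Frank-Wolfe argument: by oracle optimality and g-convexity the linear model
decreases by at least the gap `h`, so `h (k+1) ≤ (1 - s) h k + s² M_φ / 2`, and induction on `k`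
gives the rate. -/

noncomputable section

namespace RFW

/-! ### Derivatives of bilinear forms along curves. -/

section Calculus

variable {E : Type*} [NormedAddCommGroup E] [NormedSpace ℝ E]

-- Shortcut instances: with the scoped Riemannian-bundle instances open, these searches time out.
local instance dualNormedAddCommGroup : NormedAddCommGroup (E →L[ℝ] ℝ) :=
  ContinuousLinearMap.toNormedAddCommGroup

local instance dualNormedSpace : NormedSpace ℝ (E →L[ℝ] ℝ) := ContinuousLinearMap.toNormedSpace

local instance bilinNormedAddCommGroup : NormedAddCommGroup (E →L[ℝ] E →L[ℝ] ℝ) :=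
  ContinuousLinearMap.toNormedAddCommGroup

local instance bilinNormedSpace : NormedSpace ℝ (E →L[ℝ] E →L[ℝ] ℝ) :=
  ContinuousLinearMap.toNormedSpace

lemma hasDerivWithinAt_bilin {G : E → E →L[ℝ] E →L[ℝ] ℝ} {G' : E →L[ℝ] E →L[ℝ] E →L[ℝ] ℝ}
    {c v w : ℝ → E} {c' v' w' : E} {s : Set ℝ} {t : ℝ} (hG : HasFDerivAt G G' (c t))
    (hc : HasDerivWithinAt c c' s t) (hv : HasDerivWithinAt v v' s t)
    (hw : HasDerivWithinAt w w' s t) :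
    HasDerivWithinAt (fun r => G (c r) (v r) (w r))
      (G' c' (v t) (w t) + G (c t) v' (w t) + G (c t) (v t) w') s t := by
  simpa using ((hG.comp_hasDerivWithinAt t hc).clm_apply hv).clm_apply hw

lemma fderiv_bilin {G : E → E →L[ℝ] E →L[ℝ] ℝ} {G' : E →L[ℝ] E →L[ℝ] E →L[ℝ] ℝ} {u : E}
    (hG : HasFDerivAt G G' u) (v w d : E) : fderiv ℝ (fun u' => G u' v w) u d = G' d v w := by
  rw [((hG.clm_apply (hasFDerivAt_const v _)).clm_apply (hasFDerivAt_const w _)).fderiv]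
  simp

end Calculus

/-! ### The metric in a chart. -/

section Metric

variable {E : Type*} [NormedAddCommGroup E] [NormedSpace ℝ E]
  {M : Type*} [MetricSpace M] [ChartedSpace E M]
  [RiemannianBundle (fun x : M => TangentSpace 𝓘(ℝ, E) x)]

lemma chartMetric_add_left (p : M) (u v₁ v₂ w : E) :
    chartMetric p u (v₁ + v₂) w = chartMetric p u v₁ w + chartMetric p u v₂ w := by
  have h := (mfderiv 𝓘(ℝ, E) 𝓘(ℝ, E) (chartInv p) u).map_add v₁ v₂
  unfold chartMetric
  exact (congrArg (fun z => inner ℝ z _) h).trans (inner_add_left _ _ _)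

lemma chartMetric_smul_left (p : M) (u : E) (a : ℝ) (v w : E) :
    chartMetric p u (a • v) w = a * chartMetric p u v w := by
  have h := (mfderiv 𝓘(ℝ, E) 𝓘(ℝ, E) (chartInv p) u).map_smul a v
  unfold chartMetric
  exact (congrArg (fun z => inner ℝ z _) h).trans (real_inner_smul_left _ _ _)

lemma chartMetric_comm (p : M) (u v w : E) : chartMetric p u v w = chartMetric p u w v :=
  real_inner_comm _ _

lemma chartMetric_add_right (p : M) (u v w₁ w₂ : E) :
    chartMetric p u v (w₁ + w₂) = chartMetric p u v w₁ + chartMetric p u v w₂ := by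
  simp only [chartMetric_comm p u v, chartMetric_add_left]

lemma chartMetric_smul_right (p : M) (u : E) (a : ℝ) (v w : E) :
    chartMetric p u v (a • w) = a * chartMetric p u v w := by
  simp only [chartMetric_comm p u v, chartMetric_smul_left]

lemma christoffel_smul_smul (p : M) (u : E) (a b : ℝ) (v w z : E) :
    christoffel p u (a • v) (b • w) z = a * b * christoffel p u v w z := by
  have key : ∀ (c : ℝ) (f : E → ℝ), fderiv ℝ (fun u' => c * f u') u = c • fderiv ℝ f u :=
    fun c f => congrFun (fderiv_const_smul_field c (f := f)) u
  simp only [christoffel, chartMetric_smul_left, chartMetric_smul_right, key, map_smul,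
    smul_apply, smul_eq_mul]
  ring

/-- The metric coefficients in the chart centred at `p` as a continuous bilinear form. -/
def chartForm [FiniteDimensional ℝ E] (p : M) (u : E) : E →L[ℝ] E →L[ℝ] ℝ :=
  (LinearMap.mk₂ ℝ (chartMetric p u) (chartMetric_add_left p u) (chartMetric_smul_left p u)
    (chartMetric_add_right p u) (chartMetric_smul_right p u)).toContinuousBilinearMap

variable [IsManifold 𝓘(ℝ, E) ∞ M]

/-- The differentials of the chart and of its inverse cancel, so inner products can be computed in
coordinates. -/
lemma chartMetric_extChartAt {p q : M} (hq : q ∈ (extChartAt 𝓘(ℝ, E) p).source)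
    (v w : TangentSpace 𝓘(ℝ, E) q) :
    chartMetric p (extChartAt 𝓘(ℝ, E) p q)
      (mfderiv 𝓘(ℝ, E) 𝓘(ℝ, E) (extChartAt 𝓘(ℝ, E) p) q v)
      (mfderiv 𝓘(ℝ, E) 𝓘(ℝ, E) (extChartAt 𝓘(ℝ, E) p) q w) = inner ℝ v w := by
  obtain ⟨u, hu, rfl⟩ : ∃ u ∈ (extChartAt 𝓘(ℝ, E) p).target, chartInv p u = q :=
    ⟨_, (extChartAt 𝓘(ℝ, E) p).map_source hq, (extChartAt 𝓘(ℝ, E) p).left_inv hq⟩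
  have hru : extChartAt 𝓘(ℝ, E) p (chartInv p u) = u := (extChartAt 𝓘(ℝ, E) p).right_inv hu
  have hid := mfderivWithin_extChartAt_symm_comp_mfderiv_extChartAt (I := 𝓘(ℝ, E)) (x := p) hu
  simp only [modelWithCornersSelf_coe, range_id, mfderivWithin_univ] at hid
  have key : ∀ v : TangentSpace 𝓘(ℝ, E) (chartInv p u),
      mfderiv 𝓘(ℝ, E) 𝓘(ℝ, E) (chartInv p) u
        (mfderiv 𝓘(ℝ, E) 𝓘(ℝ, E) (extChartAt 𝓘(ℝ, E) p) (chartInv p u) v) = v :=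
    fun v => DFunLike.congr_fun hid v
  have main : chartMetric p u
      (mfderiv 𝓘(ℝ, E) 𝓘(ℝ, E) (extChartAt 𝓘(ℝ, E) p) (chartInv p u) v)
      (mfderiv 𝓘(ℝ, E) 𝓘(ℝ, E) (extChartAt 𝓘(ℝ, E) p) (chartInv p u) w) = inner ℝ v w := by
    unfold chartMetric
    rw [key v, key w]
  exact (congrArg (fun y => chartMetric p y _ _) hru).trans main

variable [IsContMDiffRiemannianBundle 𝓘(ℝ, E) ∞ E (fun x : M => TangentSpace 𝓘(ℝ, E) x)]

lemma contMDiffOn_inner {b : E → M} {V W : ∀ u : E, TangentSpace 𝓘(ℝ, E) (b u)} {s : Set E}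
    (hV : ContMDiffOn 𝓘(ℝ, E) 𝓘(ℝ, E).tangent ∞
      (fun u => (⟨b u, V u⟩ : TangentBundle 𝓘(ℝ, E) M)) s)
    (hW : ContMDiffOn 𝓘(ℝ, E) 𝓘(ℝ, E).tangent ∞
      (fun u => (⟨b u, W u⟩ : TangentBundle 𝓘(ℝ, E) M)) s) :
    ContMDiffOn 𝓘(ℝ, E) 𝓘(ℝ, ℝ) ∞ (fun u => inner ℝ (V u) (W u)) s :=
  ContMDiffOn.inner_bundle (IB := 𝓘(ℝ, E)) (F := E) (E := fun x : M => TangentSpace 𝓘(ℝ, E) x) hV hW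

lemma contDiffOn_chartMetric (p : M) (v w : E) :
    ContDiffOn ℝ ∞ (fun u => chartMetric p u v w) (extChartAt 𝓘(ℝ, E) p).target := by
  have ho : IsOpen (extChartAt 𝓘(ℝ, E) p).target := isOpen_extChartAt_target p
  have hmap := (contMDiffOn_extChartAt_symm (I := 𝓘(ℝ, E)) (n := ∞) p).contMDiffOn_tangentMapWithin
    (m := ∞) (by simp) ho.uniqueMDiffOn
  -- Coordinate fields are smooth, being images of constant fields under the tangent map of the
  -- inverse chart.
  have hsec : ∀ v : E, ContMDiffOn 𝓘(ℝ, E) 𝓘(ℝ, E).tangent ∞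
      (fun u => (⟨chartInv p u, mfderiv 𝓘(ℝ, E) 𝓘(ℝ, E) (chartInv p) u v⟩ :
        TangentBundle 𝓘(ℝ, E) M)) (extChartAt 𝓘(ℝ, E) p).target := by
    intro v
    have hconst : ContMDiffOn 𝓘(ℝ, E) 𝓘(ℝ, E).tangent ∞
        (fun u : E => (⟨u, v⟩ : TangentBundle 𝓘(ℝ, E) E)) (extChartAt 𝓘(ℝ, E) p).target :=
      contMDiffOn_vectorSpace_iff_contDiffOn.2 contDiffOn_const
    refine (hmap.comp hconst fun u hu => hu).congr fun u hu => ?_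
    have hD : mfderivWithin 𝓘(ℝ, E) 𝓘(ℝ, E) (extChartAt 𝓘(ℝ, E) p).symm
        (extChartAt 𝓘(ℝ, E) p).target u = mfderiv 𝓘(ℝ, E) 𝓘(ℝ, E) (chartInv p) u :=
      mfderivWithin_of_isOpen ho hu
    simp only [Function.comp_apply, tangentMapWithin, hD]
    rfl
  have hinner : ContMDiffOn 𝓘(ℝ, E) 𝓘(ℝ, ℝ) ∞ (fun u => chartMetric p u v w)
      (extChartAt 𝓘(ℝ, E) p).target :=
    contMDiffOn_inner (b := chartInv p) (hsec v) (hsec w)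
  exact hinner.contDiffOn

lemma differentiableAt_chartForm [FiniteDimensional ℝ E] {p : M} {u : E}
    (hu : u ∈ (extChartAt 𝓘(ℝ, E) p).target) : DifferentiableAt ℝ (chartForm (M := M) p) u := by
  have h : ContDiffOn ℝ ∞ (chartForm (M := M) p) (extChartAt 𝓘(ℝ, E) p).target :=
    contDiffOn_clm_apply.2 fun v => contDiffOn_clm_apply.2 fun w => contDiffOn_chartMetric p v w
  exact (h.contDiffAt ((isOpen_extChartAt_target p).mem_nhds hu)).differentiableAt (by simp)

end Metric

/-! ### Metric compatibility of parallel transport. -/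

section Parallel

variable {E : Type*} [NormedAddCommGroup E] [NormedSpace ℝ E] [FiniteDimensional ℝ E]
  {M : Type*} [MetricSpace M] [ChartedSpace E M] [IsManifold 𝓘(ℝ, E) ∞ M]
  [RiemannianBundle (fun x : M => TangentSpace 𝓘(ℝ, E) x)]
  [IsContMDiffRiemannianBundle 𝓘(ℝ, E) ∞ E (fun x : M => TangentSpace 𝓘(ℝ, E) x)]

lemma hasDerivWithinAt_inner_of_isParallelAlong {γ : ℝ → M}
    {V W : ∀ s, TangentSpace 𝓘(ℝ, E) (γ s)} (hγ : ContinuousOn γ (Icc 0 1))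
    (hV : IsParallelAlong γ V) (hW : IsParallelAlong γ W) {t : ℝ} (ht : t ∈ Icc (0 : ℝ) 1) :
    HasDerivWithinAt (fun s => inner ℝ (V s) (W s)) 0 (Icc 0 1) t := by
  obtain ⟨c', v', hc, hv, hV'⟩ := hV t ht
  obtain ⟨c'', w', hc2, hw, hW'⟩ := hW t ht
  obtain rfl : c' = c'' := (uniqueDiffOn_Icc_zero_one t ht).eq_deriv _ hc hc2
  have hsrc : γ t ∈ (extChartAt 𝓘(ℝ, E) (γ t)).source := mem_extChartAt_source (γ t)
  have hu : coordCurve (E := E) (γ t) γ t ∈ (extChartAt 𝓘(ℝ, E) (γ t)).target :=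
    (extChartAt 𝓘(ℝ, E) (γ t)).map_source hsrc
  obtain ⟨G', hG⟩ := differentiableAt_chartForm (M := M) hu
  have hfd : ∀ v w d : E, fderiv ℝ (fun u => chartMetric (γ t) u v w)
      (coordCurve (E := E) (γ t) γ t) d = G' d v w := fderiv_bilin hG
  have hder := hasDerivWithinAt_bilin hG hc hv hw
  have hzero : (G' c') (coordField (γ t) γ V t) (coordField (γ t) γ W t)
      + chartMetric (γ t) (coordCurve (E := E) (γ t) γ t) v' (coordField (γ t) γ W t)
      + chartMetric (γ t) (coordCurve (E := E) (γ t) γ t) (coordField (γ t) γ V t) w' = 0 := by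
    have h1 := hV' (coordField (γ t) γ W t)
    have h2 := hW' (coordField (γ t) γ V t)
    -- By symmetry of the metric, the last two terms of the Christoffel symbols cancel in `Γ(c', V;
    -- W) + Γ(c', W; V)`, leaving `∂_{c'} g(V, W)`.
    have hs : ∀ d v w : E, G' d v w = G' d w v := fun d v w => by
      rw [← hfd, ← hfd]
      simp_rw [chartMetric_comm (γ t) _ v w]
    simp only [christoffel, hfd] at h1 h2
    rw [chartMetric_comm _ _ _ w']
    rw [hs c' (coordField (γ t) γ W t)] at h2
    linarith
  have hev : ∀ᶠ s in 𝓝[Icc 0 1] t, inner ℝ (V s) (W s) =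
      chartForm (γ t) (coordCurve (E := E) (γ t) γ s) (coordField (γ t) γ V s)
        (coordField (γ t) γ W s) := by
    filter_upwards [(hγ t ht).preimage_mem_nhdsWithin
      (extChartAt_source_mem_nhds (I := 𝓘(ℝ, E)) (γ t))] with s hs
    exact (chartMetric_extChartAt hs (V s) (W s)).symm
  refine (hder.congr_of_eventuallyEq hev (hev.self_of_nhdsWithin ht)).congr_deriv ?_
  exact hzero

lemma inner_eq_of_isParallelAlong {γ : ℝ → M}
    {V W : ∀ s, TangentSpace 𝓘(ℝ, E) (γ s)} (hγ : ContinuousOn γ (Icc 0 1))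
    (hV : IsParallelAlong γ V) (hW : IsParallelAlong γ W) {t : ℝ} (ht : t ∈ Icc (0 : ℝ) 1) :
    inner ℝ (V t) (W t) = inner ℝ (V 0) (W 0) := by
  have hd := fun s hs => hasDerivWithinAt_inner_of_isParallelAlong hγ hV hW (t := s) hs
  exact constant_of_derivWithin_zero (fun s hs => (hd s hs).differentiableWithinAt)
    (fun s hs => (hd s ⟨hs.1, hs.2.le⟩).derivWithin
      (uniqueDiffOn_Icc_zero_one s ⟨hs.1, hs.2.le⟩)) t ht

end Parallel

/-! ### Geodesics: restriction, constant speed, length. -/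

section Geodesic

variable {E : Type*} [NormedAddCommGroup E] [NormedSpace ℝ E]
  {M : Type*} [MetricSpace M] [ChartedSpace E M]
  [RiemannianBundle (fun x : M => TangentSpace 𝓘(ℝ, E) x)]

lemma IsGeodesic.continuousOn {γ : ℝ → M} (hγ : IsGeodesic E γ) : ContinuousOn γ (Icc 0 1) :=
  hγ.1.continuousOn

lemma IsGeodesic.mdifferentiableOn {γ : ℝ → M} (hγ : IsGeodesic E γ) :
    MDifferentiableOn 𝓘(ℝ, ℝ) 𝓘(ℝ, E) γ (Icc 0 1) :=
  hγ.1.mdifferentiableOn (by simp)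

lemma IsMinGeodesicFrom.map_zero {γ : ℝ → M} {x y : M} {v : TangentSpace 𝓘(ℝ, E) x}
    (h : IsMinGeodesicFrom γ x y v) : γ 0 = x :=
  congrArg (fun p : TangentBundle 𝓘(ℝ, E) M => p.1) h.2.2

lemma mapsTo_mul_Icc {r : ℝ} (hr : r ∈ Icc (0 : ℝ) 1) :
    MapsTo (fun s => r * s) (Icc (0 : ℝ) 1) (Icc 0 1) := fun _ hs =>
  ⟨mul_nonneg hr.1 hs.1, mul_le_one₀ hr.2 hs.1 hs.2⟩

lemma velocity_comp_mul {γ : ℝ → M} (hγ : IsGeodesic E γ) {r : ℝ} (hr : r ∈ Icc (0 : ℝ) 1)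
    {s : ℝ} (hs : s ∈ Icc (0 : ℝ) 1) :
    (velocity (fun s => γ (r * s)) s : TangentSpace 𝓘(ℝ, E) (γ (r * s)))
      = r • velocity γ (r * s) := by
  have hd : HasDerivWithinAt (fun s : ℝ => r * s) r (Icc 0 1) s := by
    simpa using ((hasDerivAt_id s).const_mul r).hasDerivWithinAt
  have hm := hd.hasFDerivWithinAt.hasMFDerivWithinAt
  have hγ' := (hγ.mdifferentiableOn _ (mapsTo_mul_Icc hr hs)).hasMFDerivWithinAt
  have hcomp := (HasMFDerivWithinAt.comp s hγ' hm (mapsTo_mul_Icc hr)).mfderivWithin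
    (uniqueDiffOn_Icc_zero_one s hs).uniqueMDiffWithinAt
  have h1 : (velocity (fun s => γ (r * s)) s : TangentSpace 𝓘(ℝ, E) (γ (r * s)))
      = mfderivWithin 𝓘(ℝ, ℝ) 𝓘(ℝ, E) γ (Icc 0 1) (r * s) ((1 : ℝ) * r) :=
    DFunLike.congr_fun hcomp (1 : ℝ)
  rw [h1, show (1 : ℝ) * r = r • (1 : ℝ) by simp]
  exact map_smul (mfderivWithin 𝓘(ℝ, ℝ) 𝓘(ℝ, E) γ (Icc 0 1) (r * s)) r (1 : ℝ)

lemma IsGeodesic.comp_mul {γ : ℝ → M} (hγ : IsGeodesic E γ) {r : ℝ} (hr : r ∈ Icc (0 : ℝ) 1) :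
    IsGeodesic E (fun s => γ (r * s)) := by
  refine ⟨hγ.1.comp (contDiff_const.mul contDiff_id).contMDiff.contMDiffOn (mapsTo_mul_Icc hr),
    fun s hs => ?_⟩
  obtain ⟨c', v', hc, hv, h⟩ := hγ.2 (r * s) (mapsTo_mul_Icc hr hs)
  have hd : HasDerivWithinAt (fun s : ℝ => r * s) r (Icc 0 1) s := by
    simpa using ((hasDerivAt_id s).const_mul r).hasDerivWithinAt
  have hfield : ∀ s' ∈ Icc (0 : ℝ) 1,
      coordField (γ (r * s)) (fun s => γ (r * s)) (velocity (E := E) fun s => γ (r * s)) s'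
        = r • coordField (γ (r * s)) γ (velocity (E := E) γ) (r * s') := by
    intro s' hs'
    unfold coordField
    rw [velocity_comp_mul hγ hr hs']
    exact map_smul (mfderiv 𝓘(ℝ, E) 𝓘(ℝ, E) (extChartAt 𝓘(ℝ, E) (γ (r * s))) (γ (r * s'))) r _
  refine ⟨r • c', r • r • v', hc.scomp s hd (mapsTo_mul_Icc hr),
    ((hv.scomp s hd (mapsTo_mul_Icc hr)).const_smul r).congr hfield (hfield s hs), fun z => ?_⟩
  rw [hfield s hs]
  have h := h z
  change chartMetric (γ (r * s)) (coordCurve (E := E) (γ (r * s)) γ (r * s)) (r • r • v') z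
    + christoffel (γ (r * s)) (coordCurve (E := E) (γ (r * s)) γ (r * s)) (r • c')
      (r • coordField (γ (r * s)) γ (velocity (E := E) γ) (r * s)) z = 0
  -- The geodesic equation is homogeneous of degree two in the time scale `r`.
  rw [chartMetric_smul_left, chartMetric_smul_left, christoffel_smul_smul]
  linear_combination r * r * h

variable [FiniteDimensional ℝ E] [IsManifold 𝓘(ℝ, E) ∞ M]
  [IsContMDiffRiemannianBundle 𝓘(ℝ, E) ∞ E (fun x : M => TangentSpace 𝓘(ℝ, E) x)]

lemma IsGeodesic.norm_velocity {γ : ℝ → M} (hγ : IsGeodesic E γ) {t : ℝ}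
    (ht : t ∈ Icc (0 : ℝ) 1) :
    ‖velocity (E := E) γ t‖ = ‖velocity (E := E) γ 0‖ := by
  have h := inner_eq_of_isParallelAlong hγ.continuousOn hγ.2 hγ.2 ht
  rw [real_inner_self_eq_norm_sq, real_inner_self_eq_norm_sq] at h
  exact (sq_eq_sq₀ (norm_nonneg _) (norm_nonneg _)).1 h

lemma IsGeodesic.pathELength {γ : ℝ → M} (hγ : IsGeodesic E γ) {a b : ℝ} (ha : 0 ≤ a) (hb : b ≤ 1) :
    Manifold.pathELength 𝓘(ℝ, E) γ a b
      = ENNReal.ofReal (‖velocity (E := E) γ 0‖ * (b - a)) := by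
  rw [Manifold.pathELength_eq_lintegral_mfderiv_Ioo,
    MeasureTheory.setLIntegral_congr_fun (g := fun _ => ENNReal.ofReal ‖velocity (E := E) γ 0‖)
      measurableSet_Ioo, MeasureTheory.setLIntegral_const, Real.volume_Ioo,
    ENNReal.ofReal_mul (norm_nonneg _)]
  intro t ht
  have ht' : t ∈ Ioo (0 : ℝ) 1 := ⟨ha.trans_lt ht.1, ht.2.trans_le hb⟩
  have h : mfderivWithin 𝓘(ℝ, ℝ) 𝓘(ℝ, E) γ (Icc 0 1) t = mfderiv 𝓘(ℝ, ℝ) 𝓘(ℝ, E) γ t :=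
    mfderivWithin_of_mem_nhds (Icc_mem_nhds ht'.1 ht'.2)
  have hn := hγ.norm_velocity ⟨ht'.1.le, ht'.2.le⟩
  unfold velocity at hn
  rw [h] at hn
  beta_reduce
  rw [← ofReal_norm]
  exact congrArg ENNReal.ofReal hn

lemma IsMinGeodesic.dist_eq {γ : ℝ → M} (hγ : IsMinGeodesic E γ) :
    dist (γ 0) (γ 1) = ‖velocity (E := E) γ 0‖ := by
  have h := hγ.2
  rw [hγ.1.pathELength le_rfl le_rfl, edist_dist, sub_zero, mul_one] at h
  exact ((ENNReal.ofReal_eq_ofReal_iff (norm_nonneg _) dist_nonneg).1 h).symm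

variable [IsRiemannianManifold 𝓘(ℝ, E) M]

lemma IsGeodesic.dist_le {γ : ℝ → M} (hγ : IsGeodesic E γ) {a b : ℝ} (ha : 0 ≤ a)
    (hab : a ≤ b) (hb : b ≤ 1) :
    dist (γ a) (γ b) ≤ ‖velocity (E := E) γ 0‖ * (b - a) := by
  have hsmooth : ContMDiffOn 𝓘(ℝ, ℝ) 𝓘(ℝ, E) 1 γ (Icc a b) :=
    (hγ.1.of_le (by simp)).mono (Icc_subset_Icc ha hb)
  have h := Manifold.riemannianEDist_le_pathELength hsmooth rfl rfl hab
  rw [← IsRiemannianManifold.out (I := 𝓘(ℝ, E)) (γ a) (γ b), hγ.pathELength ha hb,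
    edist_dist] at h
  exact (ENNReal.ofReal_le_ofReal_iff
    (mul_nonneg (norm_nonneg _) (sub_nonneg.2 hab))).1 h

lemma IsMinGeodesic.dist_zero_eq {γ : ℝ → M} (hγ : IsMinGeodesic E γ) {t : ℝ}
    (ht : t ∈ Icc (0 : ℝ) 1) : dist (γ 0) (γ t) = t * dist (γ 0) (γ 1) := by
  have h1 := hγ.1.dist_le le_rfl ht.1 ht.2
  have h2 := hγ.1.dist_le ht.1 ht.2 le_rfl
  rw [← hγ.dist_eq] at h1 h2
  -- The upper bounds for the two pieces add up to the full distance, so neither can be strict.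
  have h3 := dist_triangle (γ 0) (γ t) (γ 1)
  linarith

lemma IsMinGeodesic.comp_mul {γ : ℝ → M} (hγ : IsMinGeodesic E γ) {r : ℝ}
    (hr : r ∈ Icc (0 : ℝ) 1) : IsMinGeodesic E (fun s => γ (r * s)) := by
  refine ⟨hγ.1.comp_mul hr, ?_⟩
  have hv : ‖velocity (E := E) (fun s => γ (r * s)) 0‖ = r * ‖velocity (E := E) γ 0‖ := by
    have h0 : (0 : ℝ) ∈ Icc (0 : ℝ) 1 := ⟨le_rfl, zero_le_one⟩
    have hr0 : r * 0 ∈ Icc (0 : ℝ) 1 := mapsTo_mul_Icc hr h0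
    rw [velocity_comp_mul hγ.1 hr h0, norm_smul, Real.norm_of_nonneg hr.1,
      hγ.1.norm_velocity hr0]
  rw [(hγ.1.comp_mul hr).pathELength le_rfl le_rfl, hv, edist_dist]
  beta_reduce
  rw [mul_zero, mul_one,
    hγ.dist_zero_eq hr, hγ.dist_eq, sub_zero, mul_one]

lemma IsMinGeodesic.isInvExp_smul {γ : ℝ → M} (hγ : IsMinGeodesic E γ) {r : ℝ}
    (hr : r ∈ Icc (0 : ℝ) 1) : IsInvExp (γ 0) (γ r) (r • velocity (E := E) γ 0) := by
  refine ⟨fun s => γ (r * s), hγ.comp_mul hr, by simp, ?_⟩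
  rw [velocity_comp_mul hγ.1 hr ⟨le_rfl, zero_le_one⟩]
  exact congrArg (fun a => (⟨γ a, r • velocity γ a⟩ : TangentBundle 𝓘(ℝ, E) M)) (mul_zero r)

end Geodesic

/-! ### Quadratic upper bound, curvature constant, one Frank-Wolfe step. -/

section Descent

variable {E : Type*} [NormedAddCommGroup E] [NormedSpace ℝ E] [FiniteDimensional ℝ E]
  {M : Type*} [MetricSpace M] [ChartedSpace E M]
  [RiemannianBundle (fun x : M => TangentSpace 𝓘(ℝ, E) x)]

lemma inner_grad (φ : M → ℝ) (x : M) (v : TangentSpace 𝓘(ℝ, E) x) :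
    inner ℝ (grad E φ x) v = mfderiv 𝓘(ℝ, E) 𝓘(ℝ, ℝ) φ x v := by
  have : FiniteDimensional ℝ (TangentSpace 𝓘(ℝ, E) x) :=
    inferInstanceAs (FiniteDimensional ℝ E)
  have : CompleteSpace (TangentSpace 𝓘(ℝ, E) x) := FiniteDimensional.complete ℝ _
  unfold grad
  exact InnerProductSpace.toDual_symm_apply

lemma IsMinGeodesicFrom.inner_grad_eq {γ : ℝ → M} {x y : M} {v : TangentSpace 𝓘(ℝ, E) x}
    (h : IsMinGeodesicFrom γ x y v) (φ : M → ℝ) :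
    inner ℝ (grad E φ (γ 0)) (velocity (E := E) γ 0) = inner ℝ (grad E φ x) v := by
  rw [inner_grad, inner_grad]
  have key : ∀ p q : TangentBundle 𝓘(ℝ, E) M, p = q →
      mfderiv 𝓘(ℝ, E) 𝓘(ℝ, ℝ) φ p.1 p.2 = mfderiv 𝓘(ℝ, E) 𝓘(ℝ, ℝ) φ q.1 q.2 :=
    fun p q hpq => by rw [hpq]
  exact key _ _ h.2.2

lemma hasDerivWithinAt_comp_geodesic {φ : M → ℝ} {γ : ℝ → M} (hγ : IsGeodesic E γ) {t : ℝ}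
    (ht : t ∈ Icc (0 : ℝ) 1) (hφ : MDifferentiableAt 𝓘(ℝ, E) 𝓘(ℝ, ℝ) φ (γ t)) :
    HasDerivWithinAt (fun s => φ (γ s)) (inner ℝ (grad E φ (γ t)) (velocity (E := E) γ t))
      (Icc 0 1) t := by
  rw [inner_grad]
  let A : ℝ →L[ℝ] ℝ := (mfderiv 𝓘(ℝ, E) 𝓘(ℝ, ℝ) φ (γ t)).comp
    (mfderivWithin 𝓘(ℝ, ℝ) 𝓘(ℝ, E) γ (Icc 0 1) t)
  have h : HasFDerivWithinAt (fun s => φ (γ s)) A (Icc 0 1) t :=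
    (hφ.hasMFDerivAt.comp_hasMFDerivWithinAt t
      (hγ.mdifferentiableOn t ht).hasMFDerivWithinAt).hasFDerivWithinAt
  exact h.hasDerivWithinAt

lemma IsGConvexOn.nonneg_of_mem_curvatureValues {φ : M → ℝ} {X : Set M}
    (hX : IsGConvexSet E X) (hφ : IsGConvexOn E φ X) {r : ℝ} (hr : r ∈ curvatureValues E φ X) :
    0 ≤ r := by
  obtain ⟨γ, hγ, h0, h1, η, hη, w, hw, rfl⟩ := hr
  have h := hφ _ h0 _ (hX.2 γ hγ h0 h1 η ⟨hη.1.le, hη.2⟩) w hw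
  exact mul_nonneg (by positivity) (by linarith)

lemma IsLSmoothOn.mul_dist_nonneg {φ : M → ℝ} {L : ℝ} {X : Set M} (hX : IsGConvexSet E X)
    (hφ : IsLSmoothOn E L φ X) {x y : M} (hx : x ∈ X) (hy : y ∈ X) : 0 ≤ L * dist x y := by
  obtain ⟨v, γ, hγ⟩ := hX.1 x hx y hy
  obtain ⟨w, -, hw⟩ := hφ.2 γ hγ.1 (hγ.map_zero ▸ hx) (hγ.2.1 ▸ hy)
  rw [hγ.map_zero, hγ.2.1] at hw
  exact (norm_nonneg _).trans hw

lemma IsLSmoothOn.mul_dist_sq_le {φ : M → ℝ} {L : ℝ} {X : Set M} (hXb : Bornology.IsBounded X)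
    (hX : IsGConvexSet E X) (hφ : IsLSmoothOn E L φ X) {x y : M} (hx : x ∈ X) (hy : y ∈ X) :
    L * dist x y ^ 2 ≤ L * Metric.diam X ^ 2 := by
  rcases le_or_gt 0 L with hL | hL
  · exact mul_le_mul_of_nonneg_left
      (pow_le_pow_left₀ dist_nonneg (Metric.dist_le_diam_of_mem hXb hx hy) 2) hL
  -- A negative `L` forces `X` to have at most one point, and both sides vanish.
  · have hzero : ∀ {a b : M}, a ∈ X → b ∈ X → dist a b = 0 := fun ha hb =>
      le_antisymm (nonpos_of_mul_nonneg_right (hφ.mul_dist_nonneg hX ha hb) hL) dist_nonneg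
    have hsub : X.Subsingleton := fun a ha b hb => dist_eq_zero.1 (hzero ha hb)
    rw [hzero hx hy, Metric.diam_subsingleton hsub]

variable [IsManifold 𝓘(ℝ, E) ∞ M]
  [IsContMDiffRiemannianBundle 𝓘(ℝ, E) ∞ E (fun x : M => TangentSpace 𝓘(ℝ, E) x)]

lemma inner_grad_velocity_sub_le {φ : M → ℝ} {L : ℝ} {X : Set M} (hφ : IsLSmoothOn E L φ X)
    {γ : ℝ → M} (hγ : IsMinGeodesic E γ) (h0 : γ 0 ∈ X) (h1 : γ 1 ∈ X) :
    inner ℝ (grad E φ (γ 1)) (velocity (E := E) γ 1)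
      - inner ℝ (grad E φ (γ 0)) (velocity (E := E) γ 0) ≤ L * dist (γ 0) (γ 1) ^ 2 := by
  obtain ⟨w, ⟨V, hV, hV0, hV1⟩, hw⟩ := hφ.2 γ hγ h0 h1
  have h := inner_eq_of_isParallelAlong hγ.1.continuousOn hV hγ.1.2 (right_mem_Icc.2 zero_le_one)
  rw [hV0, hV1] at h
  rw [← h, ← inner_sub_left]
  refine (real_inner_le_norm _ _).trans ?_
  rw [hγ.1.norm_velocity (right_mem_Icc.2 zero_le_one), ← hγ.dist_eq, sq, ← mul_assoc]
  exact mul_le_mul_of_nonneg_right hw dist_nonneg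

variable [IsRiemannianManifold 𝓘(ℝ, E) M]

lemma IsLSmoothOn.le_add_of_isMinGeodesic {φ : M → ℝ} {L : ℝ} {X : Set M}
    (hφ : IsLSmoothOn E L φ X) {γ : ℝ → M} (hγ : IsMinGeodesic E γ)
    (hX : ∀ t ∈ Icc (0 : ℝ) 1, γ t ∈ X) :
    φ (γ 1) ≤ φ (γ 0) + inner ℝ (grad E φ (γ 0)) (velocity (E := E) γ 0)
      + L / 2 * dist (γ 0) (γ 1) ^ 2 := by
  set F : ℝ → ℝ := fun t => inner ℝ (grad E φ (γ t)) (velocity (E := E) γ t) with hF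
  set d := dist (γ 0) (γ 1) with hd
  have hderiv : ∀ t ∈ Icc (0 : ℝ) 1, HasDerivWithinAt (fun s => φ (γ s)) (F t) (Icc 0 1) t :=
    fun t ht => hasDerivWithinAt_comp_geodesic hγ.1 ht (hφ.1 _ (hX t ht))
  have hbound : ∀ t ∈ Icc (0 : ℝ) 1, F t ≤ F 0 + L * d ^ 2 * t := by
    intro t ht
    rcases ht.1.eq_or_lt with rfl | htpos
    · simp
    -- The restriction to `[0, t]` has velocity scaled by `t` and length `t d`, so `t (F t - F 0) ≤
    -- L t² d²`; then divide by `t`.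
    have h := inner_grad_velocity_sub_le hφ (hγ.comp_mul ht) (hX _ (mapsTo_mul_Icc ht (by simp)))
      (hX _ (mapsTo_mul_Icc ht (by simp)))
    rw [velocity_comp_mul hγ.1 ht (by simp), velocity_comp_mul hγ.1 ht (by simp),
      real_inner_smul_right, real_inner_smul_right, mul_zero, mul_one, hγ.dist_zero_eq ht] at h
    refine le_of_mul_le_mul_left ?_ htpos
    have h' : t * F t - t * F 0 ≤ L * (t * d) ^ 2 := h
    linarith
  have hB : ∀ t : ℝ, HasDerivAt (fun t => φ (γ 0) + F 0 * t + L / 2 * d ^ 2 * t ^ 2)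
      (F 0 + L * d ^ 2 * t) t := fun t => by
    refine ((((hasDerivAt_id t).const_mul (F 0)).const_add (φ (γ 0))).add
      (((hasDerivAt_id t).pow 2).const_mul (L / 2 * d ^ 2))).congr_deriv ?_
    simp only [id]
    push_cast
    ring
  -- Comparing derivatives replaces integration, so `F` need not be shown integrable.
  have h := image_le_of_deriv_right_le_deriv_boundary (f := fun s => φ (γ s)) (f' := F)
    (fun t ht => (hderiv t ht).continuousWithinAt)
    (fun t ht => (hderiv t ⟨ht.1, ht.2.le⟩).mono_of_mem_nhdsWithin (Icc_mem_nhdsGE_of_mem ht))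
    (B := fun t => φ (γ 0) + F 0 * t + L / 2 * d ^ 2 * t ^ 2) (by simp)
    (fun t _ => (hB t).continuousAt.continuousWithinAt) (fun t _ => (hB t).hasDerivWithinAt)
    (fun t ht => hbound t ⟨ht.1, ht.2.le⟩) (right_mem_Icc.2 zero_le_one)
  simpa using h

lemma IsLSmoothOn.le_of_mem_curvatureValues {φ : M → ℝ} {L : ℝ} {X : Set M}
    (hX : IsGConvexSet E X) (hφ : IsLSmoothOn E L φ X) {r : ℝ} (hr : r ∈ curvatureValues E φ X) :
    ∃ x ∈ X, ∃ y ∈ X, r ≤ L * dist x y ^ 2 := by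
  obtain ⟨γ, hγ, h0, h1, η, hη, w, ⟨σ, hσ⟩, rfl⟩ := hr
  refine ⟨γ 0, h0, γ 1, h1, ?_⟩
  have hη' : η ∈ Icc (0 : ℝ) 1 := ⟨hη.1.le, hη.2⟩
  have hσ0 := hσ.map_zero
  have hσ1 := hσ.2.1
  -- `σ` may differ from the restriction of `γ`; only its end points matter, and their distance is
  -- `η` times that of `γ 0` and `γ 1`.
  have h := hφ.le_add_of_isMinGeodesic hσ.1 (hX.2 σ hσ.1 (hσ0 ▸ h0)
    (hσ1 ▸ hX.2 γ hγ h0 h1 η hη'))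
  rw [hσ.inner_grad_eq, hσ0, hσ1, hγ.dist_zero_eq hη'] at h
  rw [div_mul_eq_mul_div, div_le_iff₀ (pow_pos hη.1 2)]
  linarith

lemma curvatureValues_nonempty {φ : M → ℝ} {X : Set M} (hX : IsGConvexSet E X)
    (hne : X.Nonempty) : (curvatureValues E φ X).Nonempty := by
  obtain ⟨x, hx⟩ := hne
  obtain ⟨v, γ, hγ⟩ := hX.1 x hx x hx
  exact ⟨_, γ, hγ.1, hγ.map_zero ▸ hx, hγ.2.1 ▸ hx, 1, ⟨one_pos, le_rfl⟩, _,
    hγ.1.isInvExp_smul ⟨zero_le_one, le_rfl⟩, rfl⟩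

/-- One Frank-Wolfe step with step size `s` contracts the optimality gap by `1 - s`, up to an
error `s² M_φ / 2`. -/
lemma sub_le_of_isLinearOracle {φ : M → ℝ} {X : Set M} (hX : IsGConvexSet E X)
    (hφ : IsGConvexOn E φ X) (hb : BddAbove (curvatureValues E φ X)) {xstar x z : M}
    (hxstar : xstar ∈ X) (hx : x ∈ X) {v : TangentSpace 𝓘(ℝ, E) x}
    (hz : IsLinearOracle φ X x z v) {γ : ℝ → M} (hγ : IsMinGeodesicFrom γ x z v) {s : ℝ}
    (hs : s ∈ Ioc (0 : ℝ) 1) :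
    φ (γ s) - φ xstar ≤ (1 - s) * (φ x - φ xstar) + s ^ 2 / 2 * curvatureConst E φ X := by
  have h0 := hγ.map_zero
  have hmem : 2 / s ^ 2 * (φ (γ s) - φ (γ 0)
      - inner ℝ (grad E φ (γ 0)) (s • velocity (E := E) γ 0)) ∈ curvatureValues E φ X :=
    ⟨γ, hγ.1, h0 ▸ hx, hγ.2.1 ▸ hz.1, s, hs, _, hγ.1.isInvExp_smul ⟨hs.1.le, hs.2⟩, rfl⟩
  have h := le_csSup hb hmem
  rw [real_inner_smul_right, hγ.inner_grad_eq, h0, div_mul_eq_mul_div,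
    div_le_iff₀ (pow_pos hs.1 2)] at h
  -- The direction towards `xstar` competes in the oracle, and g-convexity bounds its value by `φ
  -- xstar - φ x`.
  obtain ⟨u, hu⟩ := hX.1 x hx xstar hxstar
  have h1 := hz.2.2 xstar hxstar u hu
  have h2 := hφ x hx xstar hxstar u hu
  have h3 : s * inner ℝ (grad E φ x) v ≤ s * (φ xstar - φ x) :=
    mul_le_mul_of_nonneg_left (by linarith) hs.1.le
  unfold curvatureConst
  linarith

end Descent

/-! ### The scalar recursion and the conclusion. -/

lemma le_div_of_frankWolfe_recursion {h : ℕ → ℝ} {C : ℝ} (hC : 0 ≤ C)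
    (hrec : ∀ k : ℕ, h (k + 1) ≤ (1 - 2 / ((k : ℝ) + 2)) * h k + (2 / ((k : ℝ) + 2)) ^ 2 / 2 * C)
    {k : ℕ} (hk : 1 ≤ k) : h k ≤ 2 * C / ((k : ℝ) + 2) := by
  induction k, hk using Nat.le_induction with
  | base =>
    -- The first step size is 1, so `h 0` drops out and `h 1 ≤ C / 2 ≤ 2 C / 3`.
    have := hrec 0
    norm_num at this ⊢
    linarith
  | succ k hk ih =>
    refine (hrec k).trans ?_
    have hk0 : (0 : ℝ) ≤ k := Nat.cast_nonneg k
    have hcoef : 0 ≤ 1 - 2 / ((k : ℝ) + 2) := by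
      rw [sub_nonneg, div_le_one (by positivity)]
      linarith
    refine (add_le_add_left (mul_le_mul_of_nonneg_left ih hcoef) _).trans ?_
    have heq : (1 - 2 / ((k : ℝ) + 2)) * (2 * C / ((k : ℝ) + 2)) + (2 / ((k : ℝ) + 2)) ^ 2 / 2 * C
        = 2 * C * (((k : ℝ) + 1) / ((k : ℝ) + 2) ^ 2) := by
      field_simp
      ring
    rw [heq, div_eq_mul_inv (2 * C)]
    push_cast
    refine mul_le_mul_of_nonneg_left ?_ (by positivity)
    -- What remains is `(k + 1)(k + 3) ≤ (k + 2)²`.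
    rw [← one_div, div_le_div_iff₀ (by positivity) (by positivity)]
    nlinarith

end RFW

end

theorem theorem1
    {E : Type*} [NormedAddCommGroup E] [NormedSpace ℝ E] [FiniteDimensional ℝ E]
    {M : Type*} [MetricSpace M] [ChartedSpace E M] [IsManifold 𝓘(ℝ, E) ∞ M]
    [RiemannianBundle (fun x : M => TangentSpace 𝓘(ℝ, E) x)]
    [IsContMDiffRiemannianBundle 𝓘(ℝ, E) ∞ E (fun x : M => TangentSpace 𝓘(ℝ, E) x)]
    [IsRiemannianManifold 𝓘(ℝ, E) M]
    (X : Set M) (hXcompact : IsCompact X) (hXconvex : RFW.IsGConvexSet E X)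
    (φ : M → ℝ) (L : ℝ)
    (hφconvex : RFW.IsGConvexOn E φ X) (hφsmooth : RFW.IsLSmoothOn E L φ X)
    (xstar : M) (hxstar : xstar ∈ X) (hmin : IsMinOn φ X xstar)
    (x : ℕ → M) (hx : RFW.IsRFWSequence E φ X (fun k => 2 / ((k : ℝ) + 2)) x) :
    BddAbove (RFW.curvatureValues E φ X) ∧
    RFW.curvatureConst E φ X ≤ L * Metric.diam X ^ 2 ∧
    (∀ k : ℕ, 1 ≤ k →
      φ (x k) - φ xstar ≤ 2 * RFW.curvatureConst E φ X / ((k : ℝ) + 2)) ∧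
    (fun k => φ (x k) - φ xstar) =O[atTop] (fun k : ℕ => 1 / (k : ℝ)) := by
  have hle : ∀ r ∈ RFW.curvatureValues E φ X, r ≤ L * Metric.diam X ^ 2 := fun r hr => by
    obtain ⟨a, ha, b, hb, hab⟩ := hφsmooth.le_of_mem_curvatureValues hXconvex hr
    exact hab.trans (hφsmooth.mul_dist_sq_le hXcompact.isBounded hXconvex ha hb)
  have hbdd : BddAbove (RFW.curvatureValues E φ X) := ⟨_, hle⟩
  have hne := RFW.curvatureValues_nonempty (φ := φ) hXconvex ⟨xstar, hxstar⟩
  have hC : 0 ≤ RFW.curvatureConst E φ X := Real.sSup_nonneg fun r hr =>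
    hφconvex.nonneg_of_mem_curvatureValues hXconvex hr
  have hs : ∀ k : ℕ, 2 / ((k : ℝ) + 2) ∈ Ioc (0 : ℝ) 1 := fun k =>
    ⟨by positivity, (div_le_one (by positivity)).2 (by linarith [Nat.cast_nonneg (α := ℝ) k])⟩
  have hmem : ∀ k, x k ∈ X := fun k => by
    induction k with
    | zero => exact hx.1
    | succ k ih =>
      obtain ⟨z, v, γ, hz, hγ, hxk⟩ := hx.2 k
      rw [hxk]
      exact hXconvex.2 γ hγ.1 (hγ.map_zero ▸ ih) (hγ.2.1 ▸ hz.1) _ ⟨(hs k).1.le, (hs k).2⟩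
  have hrate : ∀ k : ℕ, 1 ≤ k →
      φ (x k) - φ xstar ≤ 2 * RFW.curvatureConst E φ X / ((k : ℝ) + 2) := fun k hk =>
    RFW.le_div_of_frankWolfe_recursion (h := fun k => φ (x k) - φ xstar) hC (fun k => by
      obtain ⟨z, v, γ, hz, hγ, hxk⟩ := hx.2 k
      rw [hxk]
      exact RFW.sub_le_of_isLinearOracle hXconvex hφconvex hbdd hxstar (hmem k) hz hγ (hs k)) hk
  refine ⟨hbdd, csSup_le hne hle, hrate, ?_⟩
  refine Asymptotics.IsBigO.of_bound (2 * RFW.curvatureConst E φ X) ?_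
  filter_upwards [eventually_ge_atTop 1] with k hk
  have hk' : (0 : ℝ) < k := by exact_mod_cast hk
  -- Minimality makes the gap nonnegative, so the one-sided rate bounds its norm.
  have hgap : 0 ≤ φ (x k) - φ xstar := sub_nonneg.2 (hmin (hmem k))
  rw [Real.norm_of_nonneg hgap, Real.norm_of_nonneg (by positivity), mul_one_div]
  exact (hrate k hk).trans (div_le_div_of_nonneg_left (by positivity) hk' (by linarith))
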